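/- For a real number $x$, let $\deg(x)$ be its Turing degree, that is, the Turing degree of its left Dedekind cut $\{q\in\mathbb{Q} : q<x\}$ (rationals being coded by natural numbers in a computable way). For a set $\mathcal{S}$ of Turing degrees (of subsets of $\mathbb{N}$), put $\mathbb{R}_{\mathcal{S}}=\{x\in\mathbb{R} : \deg(x)\in\mathcal{S}\}$. Call $\mathcal{S}$ an ideal if it is nonempty, closed downward (if $\mathbf{a}\in\mathcal{S}$ and $\mathbf{b}\le_T\mathbf{a}$ then $\mathbf{b}\in\mathcal{S}$), and closed under joins (if $\mathbf{a},\mathbf{b}\in\mathcal{S}$ then $\mathbf{a}\oplus\mathbf{b}\in\mathcal{S}$). **Theorem.** For every set $\mathcal{S}$ of Turing degrees, $\mathbb{R}_{\mathcal{S}}$ is a subfield of $\mathbb{R}$ if and only if $\mathcal{S}$ is an ideal. -/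

import Mathlib

namespace TuringReals

open Classical in
/-- The characteristic function of a set of natural numbers, as a (total) oracle. -/
noncomputable def charFn (A : Set ℕ) : ℕ →. ℕ :=
  fun n => Part.some (if n ∈ A then 1 else 0)

/-- `A ≤_T B` for sets of natural numbers: the characteristic function of `A` is computable
with the characteristic function of `B` as an oracle. -/
def SetReducible (A B : Set ℕ) : Prop := TuringReducible (charFn A) (charFn B)

theorem SetReducible.refl (A : Set ℕ) : SetReducible A A := TuringReducible.refl _

theorem SetReducible.trans {A B C : Set ℕ} (h₁ : SetReducible A B) (h₂ : SetReducible B C) :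
    SetReducible A C := TuringReducible.trans h₁ h₂

/-- Turing equivalence of sets of natural numbers. -/
def setEquiv : Setoid (Set ℕ) where
  r A B := SetReducible A B ∧ SetReducible B A
  iseqv :=
    { refl := fun A => ⟨.refl A, .refl A⟩
      symm := fun h => ⟨h.2, h.1⟩
      trans := fun h k => ⟨h.1.trans k.1, k.2.trans h.2⟩ }

/-- The Turing degrees: classes of sets of natural numbers modulo Turing equivalence.
(Mathlib's `TuringDegree` also has degrees of partial functions, which need not contain a total
function, so it is not used here.) -/
def Degree : Type := Quotient setEquiv

/-- The Turing degree of a set of natural numbers. -/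
def setDeg (A : Set ℕ) : Degree := Quotient.mk setEquiv A

/-- The order of the Turing degrees, induced by Turing reducibility. -/
instance : PartialOrder Degree where
  le := Quotient.lift₂ SetReducible fun _ _ _ _ h k => propext
    ⟨fun r => (h.2.trans r).trans k.1, fun r => (h.1.trans r).trans k.2⟩
  le_refl a := Quotient.inductionOn a SetReducible.refl
  le_trans a b c := Quotient.inductionOn₃ a b c fun _ _ _ h k => SetReducible.trans h k
  le_antisymm a b := Quotient.inductionOn₂ a b fun _ _ h k => Quotient.sound ⟨h, k⟩

theorem setDeg_le_setDeg {A B : Set ℕ} : setDeg A ≤ setDeg B ↔ SetReducible A B := Iff.rfl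

/-- The Turing join `A ⊕ B = {2n : n ∈ A} ∪ {2n + 1 : n ∈ B}` of two sets. -/
def setJoin (A B : Set ℕ) : Set ℕ :=
  (fun n => 2 * n) '' A ∪ (fun n => 2 * n + 1) '' B

theorem two_mul_mem_setJoin {A B : Set ℕ} {n : ℕ} : 2 * n ∈ setJoin A B ↔ n ∈ A := by
  constructor
  · rintro (⟨m, hm, h⟩ | ⟨m, _, h⟩)
    · obtain rfl : m = n := by simp only at h; omega
      exact hm
    · simp only at h; omega
  · exact fun h => Or.inl ⟨n, h, rfl⟩

theorem two_mul_add_one_mem_setJoin {A B : Set ℕ} {n : ℕ} :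
    2 * n + 1 ∈ setJoin A B ↔ n ∈ B := by
  constructor
  · rintro (⟨m, _, h⟩ | ⟨m, hm, h⟩)
    · simp only at h; omega
    · obtain rfl : m = n := by simp only at h; omega
      exact hm
  · exact fun h => Or.inr ⟨n, h, rfl⟩

theorem part_some_bind (k : ℕ) (g : ℕ →. ℕ) : (Part.some k >>= g) = g k := Part.bind_some k g

theorem setReducible_of_primrec {A B : Set ℕ} {f : ℕ → ℕ} (hf : Primrec f)
    (h : ∀ n, f n ∈ B ↔ n ∈ A) : SetReducible A B := by
  refine RecursiveIn.iff_nat.2 ?_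
  refine ((Nat.RecursiveIn.oracle (charFn B) (Set.mem_singleton _)).comp
    (Nat.Primrec.recursiveIn (Primrec.nat_iff.1 hf))).of_eq fun n => ?_
  by_cases hn : n ∈ A <;> simp [charFn, part_some_bind, h, hn]

theorem left_le_setJoin (A B : Set ℕ) : SetReducible A (setJoin A B) :=
  setReducible_of_primrec (f := fun n => 2 * n)
    (Primrec.nat_mul.comp (Primrec.const 2) Primrec.id) fun _ => two_mul_mem_setJoin

theorem right_le_setJoin (A B : Set ℕ) : SetReducible B (setJoin A B) :=
  setReducible_of_primrec (f := fun n => 2 * n + 1)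
    (Primrec.succ.comp (Primrec.nat_mul.comp (Primrec.const 2) Primrec.id))
    fun _ => two_mul_add_one_mem_setJoin

theorem setJoin_le {A B C : Set ℕ} (hA : SetReducible A C) (hB : SetReducible B C) :
    SetReducible (setJoin A B) C := by
  have hhalf : Nat.RecursiveIn {charFn C} (fun n => ((n / 2 : ℕ) : Part ℕ)) :=
    Nat.Primrec.recursiveIn (Primrec.nat_iff.1 Primrec.nat_div2 |>.of_eq fun n => by
      simp [Nat.div2_val])
  have hid : Nat.RecursiveIn {charFn C} (fun n => ((n : ℕ) : Part ℕ)) :=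
    Nat.Primrec.recursiveIn (Primrec.nat_iff.1 Primrec.id)
  have hsel : Nat.RecursiveIn {charFn C} (fun p => (((if p.unpair.1 % 2 = 0 then
      p.unpair.2.unpair.1 else p.unpair.2.unpair.2 : ℕ)) : Part ℕ)) := by
    refine Nat.Primrec.recursiveIn (Primrec.nat_iff.1 ?_)
    have h1 : Primrec fun p : ℕ => p.unpair.1 := Primrec.fst.comp Primrec.unpair
    have h2 : Primrec fun p : ℕ => p.unpair.2 := Primrec.snd.comp Primrec.unpair
    exact Primrec.ite (Primrec.eq.comp (Primrec.nat_mod.comp h1 (Primrec.const 2))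
      (Primrec.const 0)) (h1.comp h2) (h2.comp h2)
  refine RecursiveIn.iff_nat.2 ((hsel.comp (hid.pair
    (((RecursiveIn.iff_nat.1 hA).comp hhalf).pair
      ((RecursiveIn.iff_nat.1 hB).comp hhalf)))).of_eq fun n => ?_)
  rcases Nat.even_or_odd' n with ⟨k, rfl | rfl⟩
  · by_cases hk : k ∈ A <;> simp [charFn, Seq.seq, part_some_bind, hk, two_mul_mem_setJoin]
  · have e : (2 * k + 1) / 2 = k := by omega
    by_cases hk : k ∈ B <;> simp [charFn, Seq.seq, part_some_bind, hk, two_mul_add_one_mem_setJoin, e]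

/-- The Turing join of degrees, `setDeg A ⊔ setDeg B = setDeg (setJoin A B)`;
it is the least upper bound. -/
instance : SemilatticeSup Degree where
  sup := Quotient.lift₂ (fun A B => setDeg (setJoin A B)) fun A₁ B₁ A₂ B₂ h k => Quotient.sound
    ⟨setJoin_le (h.1.trans (left_le_setJoin A₂ B₂)) (k.1.trans (right_le_setJoin A₂ B₂)),
      setJoin_le (h.2.trans (left_le_setJoin A₁ B₁)) (k.2.trans (right_le_setJoin A₁ B₁))⟩
  le_sup_left a b := Quotient.inductionOn₂ a b left_le_setJoin
  le_sup_right a b := Quotient.inductionOn₂ a b right_le_setJoin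
  sup_le a b c := Quotient.inductionOn₃ a b c fun _ _ _ h k => setJoin_le h k

theorem setDeg_sup_setDeg (A B : Set ℕ) : setDeg A ⊔ setDeg B = setDeg (setJoin A B) := rfl

/-- A computable enumeration of the rational numbers: the code `⟨⟨a, b⟩, c⟩` stands for
`(a - b) / (c + 1)`. -/
def ratOfCode (n : ℕ) : ℚ :=
  ((n.unpair.1.unpair.1 : ℚ) - (n.unpair.1.unpair.2 : ℚ)) / ((n.unpair.2 : ℚ) + 1)

theorem ratOfCode_surjective : Function.Surjective ratOfCode := by
  intro q
  refine ⟨Nat.pair (Nat.pair q.num.toNat (-q.num).toNat) (q.den - 1), ?_⟩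
  have h1 : ((q.num.toNat : ℚ) - ((-q.num).toNat : ℚ)) = q.num := by
    exact_mod_cast Int.toNat_sub_toNat_neg q.num
  have h2 : (((q.den - 1 : ℕ) : ℚ) + 1) = q.den := by
    exact_mod_cast Nat.sub_add_cancel q.pos
  simp only [ratOfCode, Nat.unpair_pair, h1, h2]
  exact Rat.num_div_den q

/-- The left Dedekind cut of a real number, as a set of codes of rational numbers. -/
def leftCut (x : ℝ) : Set ℕ := {n | (ratOfCode n : ℝ) < x}

/-- The Turing degree of a real number: the degree of its left Dedekind cut
(equivalently, of its binary or decimal expansion). -/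
def realDeg (x : ℝ) : Degree := setDeg (leftCut x)

/-- `ℝ_𝒮`: the real numbers whose Turing degree belongs to `𝒮`. -/
def realsOf (S : Set Degree) : Set ℝ := {x | realDeg x ∈ S}

/-- A Turing ideal: a set of Turing degrees closed downward and under finite joins. The empty
join (the least degree) is among them; given downward closure this is nonemptiness. -/
structure IsTuringIdeal (S : Set Degree) : Prop where
  nonempty : S.Nonempty
  mem_of_le : ∀ a b : Degree, b ≤ a → a ∈ S → b ∈ S
  sup_mem : ∀ a b : Degree, a ∈ S → b ∈ S → a ⊔ b ∈ S

end TuringReals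

/-! The bridge between degrees and field operations is `approximableIn_iff`: an oracle computes the
left cut of `x` iff it computes rationals converging to `x` at rate `K / (n + 1)`. Sums, products,
opposites and inverses respect such approximations, so the result is computable from the join of the
cuts of the arguments. Hence an ideal yields a subfield.

Conversely, each set `A` is encoded by the real `quaternary A`, with base-4 digits 0 and 1 only, so
that comparisons with rationals recover the digits and the degree is that of `A`
(`realDeg_quaternary`). Even and odd positions do not interact, so `quaternary_setJoin` writes the
real of `A ⊕ B` as a real of degree `deg A` plus one of degree `deg B`. Addition in the field
therefore gives joins. If `B ≤ A`, then `A ⊕ B` has the degree of `A`, and subtraction gives a real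
of degree `deg B`: downward closure. -/

namespace TuringReals

/-! ### Functions computable with an oracle -/

/-- The total function `f` is computable with oracle the characteristic function of `C`. -/
def RecIn (C : Set ℕ) (f : ℕ → ℕ) : Prop :=
  Nat.RecursiveIn {charFn C} fun n => Part.some (f n)

open Classical in
/-- The total characteristic function of a set, with values `0` and `1`. -/
noncomputable def chi (A : Set ℕ) (n : ℕ) : ℕ := if n ∈ A then 1 else 0

theorem chi_eq_one {A : Set ℕ} {n : ℕ} : chi A n = 1 ↔ n ∈ A := by simp [chi]

theorem chi_eq_zero {A : Set ℕ} {n : ℕ} : chi A n = 0 ↔ n ∉ A := by simp [chi]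

theorem setReducible_iff_recIn_chi {A C : Set ℕ} : SetReducible A C ↔ RecIn C (chi A) :=
  RecursiveIn.iff_nat

theorem setReducible_of_recIn {A C : Set ℕ} {f : ℕ → ℕ} (hf : RecIn C f)
    (h1 : ∀ n ∈ A, f n = 1) (h0 : ∀ n ∉ A, f n = 0) : SetReducible A C := by
  rw [setReducible_iff_recIn_chi]
  have e : chi A = f := by
    funext n
    by_cases hn : n ∈ A
    · rw [h1 n hn, chi_eq_one.2 hn]
    · rw [h0 n hn, chi_eq_zero.2 hn]
  rwa [e]

namespace RecIn

variable {C : Set ℕ} {f g : ℕ → ℕ}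

theorem of_primrec (hf : Primrec f) : RecIn C f :=
  Nat.Primrec.recursiveIn (Primrec.nat_iff.1 hf)

theorem comp (hf : RecIn C f) (hg : RecIn C g) : RecIn C fun n => f (g n) :=
  (Nat.RecursiveIn.comp hf hg).of_eq fun _ => part_some_bind _ _

theorem pair (hf : RecIn C f) (hg : RecIn C g) : RecIn C fun n => Nat.pair (f n) (g n) :=
  (Nat.RecursiveIn.pair hf hg).of_eq fun n => by simp [Seq.seq]

theorem comp₂ {h : ℕ → ℕ → ℕ} (hh : Primrec₂ h) (hf : RecIn C f) (hg : RecIn C g) :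
    RecIn C fun n => h (f n) (g n) := by
  have := (of_primrec (C := C) (Primrec₂.unpaired.2 hh)).comp (hf.pair hg)
  simpa [Nat.unpaired] using this

/-- `Nat.RecursiveIn.prec` carries a parameter; it is set to 0 and dropped by the step function. -/
theorem natRec (c : ℕ) (hg : RecIn C g) :
    RecIn C fun n => Nat.rec c (fun k i => g (Nat.pair k i)) n := by
  have hc : RecIn C fun _ => c := of_primrec (Primrec.const c)
  have hs : RecIn C fun p => p.unpair.2 := of_primrec (Primrec.snd.comp Primrec.unpair)
  have h := Nat.RecursiveIn.prec hc (hg.comp hs)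
  have h0 : RecIn C fun n => Nat.pair 0 n :=
    of_primrec (Primrec₂.natPair.comp (Primrec.const 0) Primrec.id)
  refine (Nat.RecursiveIn.comp h h0).of_eq fun n => ?_
  refine (Part.bind_some _ _).trans ?_
  simp only [Nat.unpair_pair]
  induction n with
  | zero => rfl
  | succ n ih =>
    simp only [ih]
    exact Part.bind_some _ _

/-- Unbounded search: if the search always succeeds, some witness can be computed. -/
theorem exists_search (hg : RecIn C g) (h : ∀ a, ∃ n, g (Nat.pair a n) = 0) :
    ∃ f, RecIn C f ∧ ∀ a, g (Nat.pair a (f a)) = 0 := by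
  classical
  refine ⟨fun a => Nat.find (h a), (Nat.RecursiveIn.rfind hg).of_eq_tot fun a => ?_,
    fun a => Nat.find_spec (h a)⟩
  refine Nat.mem_rfind.2 ⟨?_, fun {m} hm => ?_⟩
  · simpa using Nat.find_spec (h a)
  · simpa using Nat.find_min (h a) hm

end RecIn

/-! ### Rational arithmetic on codes -/

/-- The code of the rational number `(a - b) / (c + 1)`. -/
def codeMk (a b c : ℕ) : ℕ := Nat.pair (Nat.pair a b) c

theorem ratOfCode_codeMk (a b c : ℕ) : ratOfCode (codeMk a b c) = ((a : ℚ) - b) / (c + 1) := by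
  simp [ratOfCode, codeMk]

theorem exists_codeMk (n : ℕ) : ∃ a b c, n = codeMk a b c :=
  ⟨n.unpair.1.unpair.1, n.unpair.1.unpair.2, n.unpair.2, by simp [codeMk]⟩

/-- The sum of rational numbers on codes. -/
def codeAdd (m n : ℕ) : ℕ :=
  codeMk (m.unpair.1.unpair.1 * (n.unpair.2 + 1) + n.unpair.1.unpair.1 * (m.unpair.2 + 1))
    (m.unpair.1.unpair.2 * (n.unpair.2 + 1) + n.unpair.1.unpair.2 * (m.unpair.2 + 1))
    -- Denominators are stored minus one: `(c + 1) * (d + 1) - 1 = c * d + c + d`.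
    (m.unpair.2 * n.unpair.2 + m.unpair.2 + n.unpair.2)

/-- The product of rational numbers on codes. -/
def codeMul (m n : ℕ) : ℕ :=
  codeMk (m.unpair.1.unpair.1 * n.unpair.1.unpair.1 + m.unpair.1.unpair.2 * n.unpair.1.unpair.2)
    (m.unpair.1.unpair.1 * n.unpair.1.unpair.2 + m.unpair.1.unpair.2 * n.unpair.1.unpair.1)
    (m.unpair.2 * n.unpair.2 + m.unpair.2 + n.unpair.2)

/-- The opposite of a rational number on codes. -/
def codeNeg (m : ℕ) : ℕ := codeMk m.unpair.1.unpair.2 m.unpair.1.unpair.1 m.unpair.2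

/-- The inverse of a nonzero rational number on codes. -/
def codeInv (m : ℕ) : ℕ :=
  -- The numerator becomes the denominator, which must be positive; hence the split on its sign.
  if m.unpair.1.unpair.2 < m.unpair.1.unpair.1 then
    codeMk (m.unpair.2 + 1) 0 (m.unpair.1.unpair.1 - m.unpair.1.unpair.2 - 1)
  else codeMk 0 (m.unpair.2 + 1) (m.unpair.1.unpair.2 - m.unpair.1.unpair.1 - 1)

/-- The comparison of rational numbers on codes, with values `0` and `1`. -/
def codeLt (m n : ℕ) : ℕ :=
  if m.unpair.1.unpair.1 * (n.unpair.2 + 1) + n.unpair.1.unpair.2 * (m.unpair.2 + 1) <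
    n.unpair.1.unpair.1 * (m.unpair.2 + 1) + m.unpair.1.unpair.2 * (n.unpair.2 + 1) then 1 else 0

theorem ratOfCode_codeAdd (m n : ℕ) :
    ratOfCode (codeAdd m n) = ratOfCode m + ratOfCode n := by
  rw [codeAdd, ratOfCode_codeMk, ratOfCode, ratOfCode,
    div_add_div _ _ (Nat.cast_add_one_ne_zero _) (Nat.cast_add_one_ne_zero _)]
  push_cast
  congr 1 <;> ring

theorem ratOfCode_codeMul (m n : ℕ) :
    ratOfCode (codeMul m n) = ratOfCode m * ratOfCode n := by
  rw [codeMul, ratOfCode_codeMk, ratOfCode, ratOfCode, div_mul_div_comm]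
  push_cast
  congr 1 <;> ring

theorem ratOfCode_codeNeg (m : ℕ) : ratOfCode (codeNeg m) = -ratOfCode m := by
  rw [codeNeg, ratOfCode_codeMk, ratOfCode, ← neg_div, neg_sub]

theorem ratOfCode_codeInv {m : ℕ} (hm : ratOfCode m ≠ 0) :
    ratOfCode (codeInv m) = (ratOfCode m)⁻¹ := by
  obtain ⟨a, b, c, rfl⟩ := exists_codeMk m
  rw [ratOfCode_codeMk] at hm
  have hab : (a : ℚ) - b ≠ 0 := fun h => hm (by rw [h, zero_div])
  have key : codeInv (codeMk a b c) =
      if b < a then codeMk (c + 1) 0 (a - b - 1) else codeMk 0 (c + 1) (b - a - 1) := by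
    simp [codeInv, codeMk]
  rw [key, ratOfCode_codeMk, inv_div]
  split_ifs with h
  · obtain ⟨d, rfl⟩ := Nat.exists_eq_add_of_lt h
    rw [ratOfCode_codeMk, show b + d + 1 - b - 1 = d by omega]
    push_cast
    congr 1 <;> ring
  · obtain ⟨d, rfl⟩ := Nat.exists_eq_add_of_lt
      (lt_of_le_of_ne (not_lt.1 h) fun e => hab (by rw [e, sub_self]))
    rw [ratOfCode_codeMk, show a + d + 1 - a - 1 = d by omega, div_eq_div_iff
      (Nat.cast_add_one_ne_zero _) hab]
    push_cast
    ring

theorem codeLt_eq (m n : ℕ) :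
    codeLt m n = if ratOfCode m < ratOfCode n then 1 else 0 := by
  have h : ratOfCode m < ratOfCode n ↔
      m.unpair.1.unpair.1 * (n.unpair.2 + 1) + n.unpair.1.unpair.2 * (m.unpair.2 + 1) <
      n.unpair.1.unpair.1 * (m.unpair.2 + 1) + m.unpair.1.unpair.2 * (n.unpair.2 + 1) := by
    rw [ratOfCode, ratOfCode, div_lt_div_iff₀ (Nat.cast_add_one_pos _) (Nat.cast_add_one_pos _),
      ← Nat.cast_lt (α := ℚ)]
    push_cast
    constructor <;> intro h <;> linarith
  simp only [codeLt, h]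

section Primrec

open Primrec

variable {α : Type*} [Primcodable α] {f g h : α → ℕ}

theorem primrec_codeMk (hf : Primrec f) (hg : Primrec g) (hh : Primrec h) :
    Primrec fun x => codeMk (f x) (g x) (h x) :=
  Primrec₂.natPair.comp (Primrec₂.natPair.comp hf hg) hh

theorem primrec_unpair_fst (hf : Primrec f) : Primrec fun x => (f x).unpair.1 :=
  fst.comp (unpair.comp hf)

theorem primrec_unpair_snd (hf : Primrec f) : Primrec fun x => (f x).unpair.2 :=
  snd.comp (unpair.comp hf)

theorem primrec_codeAdd : Primrec₂ codeAdd := by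
  have a {f : ℕ × ℕ → ℕ} (hf : Primrec f) := primrec_unpair_fst (primrec_unpair_fst hf)
  have b {f : ℕ × ℕ → ℕ} (hf : Primrec f) := primrec_unpair_snd (primrec_unpair_fst hf)
  have c {f : ℕ × ℕ → ℕ} (hf : Primrec f) := primrec_unpair_snd hf
  exact primrec_codeMk
    (nat_add.comp (nat_mul.comp (a fst) (succ.comp (c snd)))
      (nat_mul.comp (a snd) (succ.comp (c fst))))
    (nat_add.comp (nat_mul.comp (b fst) (succ.comp (c snd)))
      (nat_mul.comp (b snd) (succ.comp (c fst))))
    (nat_add.comp (nat_add.comp (nat_mul.comp (c fst) (c snd)) (c fst)) (c snd))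

theorem primrec_codeMul : Primrec₂ codeMul := by
  have a {f : ℕ × ℕ → ℕ} (hf : Primrec f) := primrec_unpair_fst (primrec_unpair_fst hf)
  have b {f : ℕ × ℕ → ℕ} (hf : Primrec f) := primrec_unpair_snd (primrec_unpair_fst hf)
  have c {f : ℕ × ℕ → ℕ} (hf : Primrec f) := primrec_unpair_snd hf
  exact primrec_codeMk
    (nat_add.comp (nat_mul.comp (a fst) (a snd)) (nat_mul.comp (b fst) (b snd)))
    (nat_add.comp (nat_mul.comp (a fst) (b snd)) (nat_mul.comp (b fst) (a snd)))
    (nat_add.comp (nat_add.comp (nat_mul.comp (c fst) (c snd)) (c fst)) (c snd))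

theorem primrec_codeNeg : Primrec codeNeg :=
  primrec_codeMk (primrec_unpair_snd (primrec_unpair_fst Primrec.id))
    (primrec_unpair_fst (primrec_unpair_fst Primrec.id)) (primrec_unpair_snd Primrec.id)

theorem primrec_codeInv : Primrec codeInv := by
  have a := primrec_unpair_fst (primrec_unpair_fst (Primrec.id (α := ℕ)))
  have b := primrec_unpair_snd (primrec_unpair_fst (Primrec.id (α := ℕ)))
  have c := primrec_unpair_snd (Primrec.id (α := ℕ))
  exact Primrec.ite (nat_lt.comp b a)
    (primrec_codeMk (succ.comp c) (const 0) (nat_sub.comp (nat_sub.comp a b) (const 1)))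
    (primrec_codeMk (const 0) (succ.comp c) (nat_sub.comp (nat_sub.comp b a) (const 1)))

theorem primrec_codeLt : Primrec₂ codeLt := by
  have a {f : ℕ × ℕ → ℕ} (hf : Primrec f) := primrec_unpair_fst (primrec_unpair_fst hf)
  have b {f : ℕ × ℕ → ℕ} (hf : Primrec f) := primrec_unpair_snd (primrec_unpair_fst hf)
  have c {f : ℕ × ℕ → ℕ} (hf : Primrec f) := primrec_unpair_snd hf
  exact Primrec.ite (nat_lt.comp
    (nat_add.comp (nat_mul.comp (a fst) (succ.comp (c snd)))
      (nat_mul.comp (b snd) (succ.comp (c fst))))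
    (nat_add.comp (nat_mul.comp (a snd) (succ.comp (c fst)))
      (nat_mul.comp (b fst) (succ.comp (c snd))))) (const 1) (const 0)

end Primrec

theorem ratOfCode_codeMk_cast (a b c : ℕ) :
    (ratOfCode (codeMk a b c) : ℝ) = ((a : ℝ) - b) / (c + 1) := by
  rw [ratOfCode_codeMk]; push_cast; rfl

theorem ratOfCode_codeAdd_cast (m n : ℕ) :
    (ratOfCode (codeAdd m n) : ℝ) = ratOfCode m + ratOfCode n := by
  rw [ratOfCode_codeAdd]; push_cast; rfl

theorem codeLt_eq_one {m n : ℕ} : codeLt m n = 1 ↔ (ratOfCode m : ℝ) < ratOfCode n := by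
  rw [codeLt_eq, Rat.cast_lt]; simp

theorem codeLt_eq_zero {m n : ℕ} : codeLt m n = 0 ↔ (ratOfCode n : ℝ) ≤ ratOfCode m := by
  rw [codeLt_eq, Rat.cast_le]; simp

theorem codeLt_le_one (m n : ℕ) : codeLt m n ≤ 1 := by
  rw [codeLt_eq]; split_ifs <;> simp

/-! ### Left cuts and rational approximations -/

/-- The real number `x` is the limit, at rate `K / (n + 1)` for some `K`, of a sequence of
rational numbers computable with oracle `C`. -/
def ApproximableIn (C : Set ℕ) (x : ℝ) : Prop :=
  ∃ (f : ℕ → ℕ) (K : ℕ), RecIn C f ∧ ∀ n : ℕ, |x - ratOfCode (f n)| ≤ K / ((n : ℝ) + 1)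

/-- The constant need only exist, so it may depend on `x` in a noncomputable way. -/
theorem approximableIn_of_bound {C : Set ℕ} {x : ℝ} {f : ℕ → ℕ} (hf : RecIn C f) (B : ℝ)
    (h : ∀ n : ℕ, |x - ratOfCode (f n)| ≤ B / ((n : ℝ) + 1)) : ApproximableIn C x := by
  obtain ⟨K, hK⟩ := exists_nat_ge B
  exact ⟨f, K, hf, fun n => (h n).trans (by gcongr)⟩

/-- Approximations never settle `q < x` at `q = x`, but comparison with a fixed rational is
decidable outright. -/
theorem leftCut_reducible_of_rat {C : Set ℕ} (c : ℕ) :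
    SetReducible (leftCut (ratOfCode c)) C :=
  setReducible_of_recIn
    (.of_primrec (primrec_codeLt.comp Primrec.id (Primrec.const c)))
    (fun _ hn => codeLt_eq_one.2 hn) fun _ hn => codeLt_eq_zero.2 (not_lt.1 hn)

/-- Comparing an irrational number with rational numbers, given approximations of it. -/
theorem leftCut_reducible_of_forall_ne {C : Set ℕ} {x : ℝ} (hx : ApproximableIn C x)
    (hne : ∀ c, x ≠ ratOfCode c) : SetReducible (leftCut x) C := by
  obtain ⟨f, K, hf, h⟩ := hx
  have hq : RecIn C fun p => p.unpair.1 := .of_primrec (primrec_unpair_fst Primrec.id)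
  have hn : RecIn C fun p => p.unpair.2 := .of_primrec (primrec_unpair_snd Primrec.id)
  have he : RecIn C fun p => codeMk K 0 p.unpair.2 := .of_primrec
    (primrec_codeMk (.const K) (.const 0) (primrec_unpair_snd Primrec.id))
  have hr := hf.comp hn
  -- The test vanishes at `⟨q, n⟩` iff `q` and `f n` differ by more than the error `K / (n + 1)`.
  have htest := RecIn.comp₂ Primrec.nat_sub (.of_primrec (.const 1))
    (RecIn.comp₂ Primrec.nat_add (.comp₂ primrec_codeLt (.comp₂ primrec_codeAdd hq he) hr)
      (.comp₂ primrec_codeLt (.comp₂ primrec_codeAdd hr he) hq))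
  have hex : ∀ q, ∃ n : ℕ, (ratOfCode q : ℝ) + K / ((n : ℝ) + 1) < ratOfCode (f n) ∨
      (ratOfCode (f n) : ℝ) + K / ((n : ℝ) + 1) < ratOfCode q := by
    intro q
    have hpos : 0 < |x - ratOfCode q| := abs_pos.2 (sub_ne_zero.2 (hne q))
    -- Twice the error falls below `|x - q|`: one error moves `x` to `f n`, the other remains as the
    -- gap.
    obtain ⟨n, hn⟩ := exists_nat_gt (2 * K / |x - ratOfCode q|)
    have hlt : 2 * (K / ((n : ℝ) + 1)) < |x - ratOfCode q| := by
      rw [← mul_div_assoc, div_lt_comm₀ (by positivity) hpos]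
      exact hn.trans (lt_add_one _)
    refine ⟨n, ?_⟩
    have h1 := abs_le.1 (h n)
    rcases lt_abs.1 hlt with h2 | h2
    · left; linarith [h1.2]
    · right; linarith [h1.1]
  obtain ⟨s, hs, hs0⟩ := htest.exists_search fun q => by
    obtain ⟨n, hn⟩ := hex q
    refine ⟨n, ?_⟩
    simp only [Nat.unpair_pair]
    rcases hn with hn | hn
    · have : codeLt (codeAdd q (codeMk K 0 n)) (f n) = 1 := by
        rw [codeLt_eq_one, ratOfCode_codeAdd_cast, ratOfCode_codeMk_cast]; simpa using hn
      omega
    · have : codeLt (codeAdd (f n) (codeMk K 0 n)) q = 1 := by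
        rw [codeLt_eq_one, ratOfCode_codeAdd_cast, ratOfCode_codeMk_cast]; simpa using hn
      omega
  have hsep : ∀ q, (ratOfCode q : ℝ) + K / ((s q : ℝ) + 1) < ratOfCode (f (s q)) ∨
      (ratOfCode (f (s q)) : ℝ) + K / ((s q : ℝ) + 1) < ratOfCode q := by
    intro q
    have h0 := hs0 q
    simp only [Nat.unpair_pair] at h0
    have l1 := codeLt_le_one (codeAdd q (codeMk K 0 (s q))) (f (s q))
    have l2 := codeLt_le_one (codeAdd (f (s q)) (codeMk K 0 (s q))) q
    rcases (by omega : codeLt (codeAdd q (codeMk K 0 (s q))) (f (s q)) = 1 ∨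
      codeLt (codeAdd (f (s q)) (codeMk K 0 (s q))) q = 1) with e | e
    · rw [codeLt_eq_one, ratOfCode_codeAdd_cast, ratOfCode_codeMk_cast] at e
      left; simpa using e
    · rw [codeLt_eq_one, ratOfCode_codeAdd_cast, ratOfCode_codeMk_cast] at e
      right; simpa using e
  -- At stage `s q` the gap exceeds the error, so `x` and `f (s q)` lie on the same side of `q`.
  refine setReducible_of_recIn (.comp₂ primrec_codeLt (.of_primrec Primrec.id) (hf.comp hs))
    (fun q hq => codeLt_eq_one.2 ?_) fun q hq => codeLt_eq_zero.2 ?_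
  all_goals
    have h1 := abs_le.1 (h (s q))
    have h2 : (0 : ℝ) ≤ K / ((s q : ℝ) + 1) := by positivity
    simp only [leftCut, Set.mem_ofPred_eq, id] at hq ⊢
    rcases hsep q with h3 | h3 <;> linarith [h1.1, h1.2]

/-- The case split is not effective; this is harmless, since a reduction is only claimed to exist
for each `x`. -/
theorem ApproximableIn.leftCut_reducible {C : Set ℕ} {x : ℝ} (hx : ApproximableIn C x) :
    SetReducible (leftCut x) C := by
  by_cases h : ∃ c, x = ratOfCode c
  · obtain ⟨c, rfl⟩ := h
    exact leftCut_reducible_of_rat c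
  · exact leftCut_reducible_of_forall_ne hx (not_exists.1 h)

/-- Two questions to the cut decide whether `q < x ≤ q + 1 / (n + 1)`; a search finds such a `q`, by
density of the rationals. -/
theorem approximableIn_of_leftCut_reducible {C : Set ℕ} {x : ℝ}
    (hx : SetReducible (leftCut x) C) : ApproximableIn C x := by
  have hchi := setReducible_iff_recIn_chi.1 hx
  have hq : RecIn C fun p => p.unpair.2 := .of_primrec (primrec_unpair_snd Primrec.id)
  have he : RecIn C fun p => codeMk 1 0 p.unpair.1 := .of_primrec
    (primrec_codeMk (.const 1) (.const 0) (primrec_unpair_fst Primrec.id))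
  have htest := RecIn.comp₂ Primrec.nat_add
    (RecIn.comp₂ Primrec.nat_sub (.of_primrec (.const 1)) (hchi.comp hq))
    (hchi.comp (.comp₂ primrec_codeAdd hq he))
  have key : ∀ n q, 1 - chi (leftCut x) q + chi (leftCut x) (codeAdd q (codeMk 1 0 n)) = 0 ↔
      (ratOfCode q : ℝ) < x ∧ x ≤ ratOfCode q + 1 / ((n : ℝ) + 1) := by
    intro n q
    have h1 : codeAdd q (codeMk 1 0 n) ∉ leftCut x ↔ x ≤ ratOfCode q + 1 / ((n : ℝ) + 1) := by
      simp [leftCut, ratOfCode_codeAdd_cast, ratOfCode_codeMk_cast]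
    rw [Nat.add_eq_zero_iff, chi_eq_zero, h1]
    refine and_congr_left' ?_
    change _ ↔ q ∈ leftCut x
    by_cases hq : q ∈ leftCut x
    · simp [hq, chi_eq_one.2 hq]
    · simp [hq, chi_eq_zero.2 hq]
  obtain ⟨s, hs, hs0⟩ := htest.exists_search fun n => by
    have hpos : (0 : ℝ) < 1 / ((n : ℝ) + 1) := by positivity
    obtain ⟨r, hr1, hr2⟩ := exists_rat_btwn (sub_lt_self x hpos)
    obtain ⟨q, rfl⟩ := ratOfCode_surjective r
    refine ⟨q, ?_⟩
    simp only [Nat.unpair_pair]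
    exact (key n q).2 ⟨hr2, by linarith⟩
  refine ⟨s, 1, hs, fun n => ?_⟩
  have h0 := hs0 n
  simp only [Nat.unpair_pair] at h0
  have h1 := (key n (s n)).1 h0
  have hpos : (0 : ℝ) ≤ 1 / ((n : ℝ) + 1) := by positivity
  rw [Nat.cast_one, abs_le]
  constructor <;> linarith [h1.1, h1.2]

theorem approximableIn_iff {C : Set ℕ} {x : ℝ} :
    ApproximableIn C x ↔ SetReducible (leftCut x) C :=
  ⟨ApproximableIn.leftCut_reducible, approximableIn_of_leftCut_reducible⟩

/-! ### Field operations on approximable reals -/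

namespace ApproximableIn

variable {C : Set ℕ} {x y : ℝ}

theorem add (hx : ApproximableIn C x) (hy : ApproximableIn C y) :
    ApproximableIn C (x + y) := by
  obtain ⟨f, K, hf, h⟩ := hx
  obtain ⟨g, L, hg, k⟩ := hy
  refine approximableIn_of_bound (.comp₂ primrec_codeAdd hf hg) (K + L) fun n => ?_
  rw [ratOfCode_codeAdd_cast, add_sub_add_comm, add_div]
  exact (abs_add_le _ _).trans (add_le_add (h n) (k n))

theorem neg (hx : ApproximableIn C x) : ApproximableIn C (-x) := by
  obtain ⟨f, K, hf, h⟩ := hx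
  refine ⟨_, K, (RecIn.of_primrec primrec_codeNeg).comp hf, fun n => ?_⟩
  rw [ratOfCode_codeNeg, Rat.cast_neg, neg_sub_neg, abs_sub_comm]
  exact h n

theorem mul (hx : ApproximableIn C x) (hy : ApproximableIn C y) :
    ApproximableIn C (x * y) := by
  obtain ⟨f, K, hf, h⟩ := hx
  obtain ⟨g, L, hg, k⟩ := hy
  refine approximableIn_of_bound (.comp₂ primrec_codeMul hf hg)
    -- From `x * y - p * q = x * (y - q) + q * (x - p)`, where `|q| ≤ |y| + L` because every error
    -- is at most `L`.
    (|x| * L + (|y| + L) * K) fun n => ?_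
  set p : ℝ := (ratOfCode (f n) : ℝ)
  set q : ℝ := (ratOfCode (g n) : ℝ)
  have hL : (L : ℝ) / ((n : ℝ) + 1) ≤ L := div_le_self (by positivity) (by simp)
  have hqb : |q| ≤ |y| + L := by
    have := abs_sub_abs_le_abs_sub q y
    rw [abs_sub_comm] at this
    linarith [k n]
  rw [ratOfCode_codeMul, Rat.cast_mul, show x * y - p * q = x * (y - q) + q * (x - p) by ring,
    add_div, mul_div_assoc, mul_div_assoc]
  refine (abs_add_le _ _).trans ?_
  rw [abs_mul, abs_mul]
  gcongr
  exacts [k n, h n]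

theorem inv (hx : ApproximableIn C x) : ApproximableIn C x⁻¹ := by
  rcases eq_or_ne x 0 with rfl | hx0
  · rwa [inv_zero]
  obtain ⟨f, K, hf, h⟩ := hx
  have hpos : 0 < |x| := abs_pos.2 hx0
  -- Past index `N` the error is at most `|x| / 2`, so the approximation `p` satisfies `|p| ≥ |x| /
  -- 2`. This keeps `p` nonzero and bounds `|x - p| / (|x| * |p|)`.
  obtain ⟨N, hN⟩ := exists_nat_gt (2 * K / |x|)
  have hsh : RecIn C fun n => f (n + N) :=
    hf.comp (.of_primrec (Primrec.nat_add.comp Primrec.id (.const N)))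
  refine approximableIn_of_bound ((RecIn.of_primrec primrec_codeInv).comp hsh)
    (K / (|x| * (|x| / 2))) fun n => ?_
  have h1 : |x - ratOfCode (f (n + N))| ≤ K / ((n : ℝ) + N + 1) := by
    simpa using h (n + N)
  set p : ℚ := ratOfCode (f (n + N))
  have hhalf : (K : ℝ) / ((n : ℝ) + N + 1) ≤ |x| / 2 := by
    rw [div_lt_iff₀ hpos] at hN
    rw [div_le_div_iff₀ (by positivity) two_pos]
    have : (0 : ℝ) ≤ |x| * n := by positivity
    nlinarith
  have hp : |x| / 2 ≤ |(p : ℝ)| := by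
    have := abs_sub_abs_le_abs_sub x p
    linarith
  have hp0 : (p : ℝ) ≠ 0 := abs_pos.1 (by linarith)
  have hle : (K : ℝ) / ((n : ℝ) + N + 1) ≤ K / ((n : ℝ) + 1) := by
    gcongr
    simp
  rw [ratOfCode_codeInv (fun e => hp0 (by exact_mod_cast e)), Rat.cast_inv,
    inv_sub_inv hx0 hp0, abs_div, abs_mul, abs_sub_comm, div_right_comm]
  gcongr
  exact h1.trans hle

end ApproximableIn

/-! ### Encoding sets by quaternary expansions -/

/-- The real number with quaternary digits `0` and `1` given by a set of natural numbers. -/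
noncomputable def quaternary (A : Set ℕ) : ℝ := ∑' n, (chi A n : ℝ) * (1 / 4) ^ (n + 1)

/-- The integer whose quaternary digits are the first `n` digits of `quaternary A`. -/
noncomputable def prefixValue (A : Set ℕ) (n : ℕ) : ℕ :=
  Nat.rec 0 (fun k i => 4 * i + chi A k) n

theorem prefixValue_succ (A : Set ℕ) (n : ℕ) :
    prefixValue A (n + 1) = 4 * prefixValue A n + chi A n := rfl

theorem chi_le_one (A : Set ℕ) (n : ℕ) : chi A n ≤ 1 := by
  rw [chi]; split_ifs <;> simp

theorem hasSum_quarter_pow : HasSum (fun n : ℕ => (1 / 4 : ℝ) ^ (n + 1)) (1 / 3) := by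
  have h := (hasSum_geometric_of_lt_one (r := (1 / 4 : ℝ)) (by norm_num) (by norm_num)).mul_right
    (1 / 4)
  norm_num [pow_succ] at h ⊢
  exact h

theorem summable_quaternary (A : Set ℕ) :
    Summable fun n => (chi A n : ℝ) * (1 / 4) ^ (n + 1) := by
  refine .of_nonneg_of_le (fun n => by positivity) (fun n => ?_) hasSum_quarter_pow.summable
  exact mul_le_of_le_one_left (by positivity) (by exact_mod_cast chi_le_one A n)

theorem prefixValue_eq_sum (A : Set ℕ) (n : ℕ) :
    (prefixValue A n : ℝ) / 4 ^ n = ∑ k ∈ Finset.range n, (chi A k : ℝ) * (1 / 4) ^ (k + 1) := by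
  induction n with
  | zero => simp [prefixValue]
  | succ n ih =>
    rw [Finset.sum_range_succ, ← ih, prefixValue_succ]
    push_cast
    rw [one_div, inv_pow, pow_succ]
    field_simp

theorem prefixValue_le_quaternary (A : Set ℕ) (n : ℕ) :
    (prefixValue A n : ℝ) / 4 ^ n ≤ quaternary A := by
  rw [prefixValue_eq_sum]
  exact (summable_quaternary A).sum_le_tsum _ fun k _ => by positivity

/-- The tail is largest when all its digits are 1, a geometric series. -/
theorem quaternary_le_prefixValue (A : Set ℕ) (n : ℕ) :
    quaternary A ≤ (prefixValue A n + 1 / 3) / 4 ^ n := by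
  rw [add_div, prefixValue_eq_sum, quaternary, ← (summable_quaternary A).sum_add_tsum_nat_add n]
  have hg := (hasSum_quarter_pow.mul_left ((1 / 4 : ℝ) ^ n))
  have : ∑' k, (chi A (k + n) : ℝ) * (1 / 4) ^ (k + n + 1) ≤ (1 / 4) ^ n * (1 / 3) := by
    rw [← hg.tsum_eq]
    refine ((summable_nat_add_iff n).2 (summable_quaternary A)).tsum_le_tsum (fun k => ?_)
      hg.summable
    rw [← pow_add, show n + (k + 1) = k + n + 1 by ring]
    exact mul_le_of_le_one_left (by positivity) (by exact_mod_cast chi_le_one A _)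
  rw [one_div_pow] at this
  rw [div_eq_mul_inv (1 / 3 : ℝ), mul_comm (1 / 3 : ℝ), ← one_div ((4 : ℝ) ^ n)]
  gcongr

/-- The digits of `quaternary A` are found one after another by comparisons with rationals. -/
theorem mem_iff_lt_quaternary (A : Set ℕ) (n : ℕ) :
    n ∈ A ↔ (8 * prefixValue A n + 1 : ℝ) / (2 * 4 ^ (n + 1)) < quaternary A := by
  -- In units of `4 ^ -(n + 1)`, with `N = prefixValue A n`, the threshold is `4 * N + 1 / 2`. Digit
  -- 1 puts the real at `4 * N + 1` or more, digit 0 at `4 * N + 1 / 3` or less.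
  have h4 : (0 : ℝ) < 4 ^ (n + 1) := by positivity
  constructor
  · intro hn
    refine lt_of_lt_of_le ?_ (prefixValue_le_quaternary A (n + 1))
    rw [prefixValue_succ, chi_eq_one.2 hn, mul_comm (2 : ℝ), ← div_div, div_right_comm]
    gcongr
    push_cast
    linarith
  · intro h
    by_contra hn
    have h1 := h.trans_le (quaternary_le_prefixValue A (n + 1))
    rw [prefixValue_succ, chi_eq_zero.2 hn, mul_comm (2 : ℝ), ← div_div, div_right_comm,
      div_lt_div_iff_of_pos_right h4] at h1
    push_cast at h1
    linarith

theorem primrec_four_pow {α : Type*} [Primcodable α] {f : α → ℕ} (hf : Primrec f) :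
    Primrec fun a => 4 ^ f a :=
  (Primrec₂.unpaired'.1 Nat.Primrec.pow).comp (.const 4) hf

theorem approximableIn_quaternary {A C : Set ℕ} (h : SetReducible A C) :
    ApproximableIn C (quaternary A) := by
  have hchi := setReducible_iff_recIn_chi.1 h
  have hN : RecIn C (prefixValue A) := by
    have hstep : RecIn C fun p => 4 * p.unpair.2 + chi A p.unpair.1 :=
      .comp₂ Primrec.nat_add
        (.of_primrec (Primrec.nat_mul.comp (.const 4) (primrec_unpair_snd Primrec.id)))
        (hchi.comp (.of_primrec (primrec_unpair_fst Primrec.id)))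
    refine (hstep.natRec 0).of_eq fun n => congrArg Part.some ?_
    simp only [Nat.unpair_pair, prefixValue]
  have hf : RecIn C fun n => codeMk (prefixValue A n) 0 (4 ^ n - 1) :=
    (hN.pair (.of_primrec (.const 0))).pair
      (.of_primrec (Primrec.nat_sub.comp (primrec_four_pow Primrec.id) (.const 1)))
  refine ⟨_, 1, hf, fun n => ?_⟩
  have h1 : (1 : ℕ) ≤ 4 ^ n := Nat.one_le_pow _ _ (by norm_num)
  have hn : ((n : ℝ) + 1) ≤ 4 ^ n := by exact_mod_cast n.lt_pow_self (by norm_num : 1 < 4)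
  rw [ratOfCode_codeMk_cast, Nat.cast_sub h1]
  push_cast
  rw [sub_zero, sub_add_cancel,
    abs_of_nonneg (sub_nonneg.2 (prefixValue_le_quaternary A n))]
  have h2 := quaternary_le_prefixValue A n
  rw [add_div] at h2
  have h3 : (1 / 3 : ℝ) / 4 ^ n ≤ 1 / ((n : ℝ) + 1) := by
    gcongr
    norm_num
  linarith

/-- Each digit is one query to the cut, at a rational built from the digits already found; the
recursion computes `prefixValue A`. -/
theorem reducible_leftCut_quaternary (A : Set ℕ) : SetReducible A (leftCut (quaternary A)) := by
  set C := leftCut (quaternary A) with hC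
  have hcode : Primrec fun p : ℕ =>
      codeMk (8 * p.unpair.2 + 1) 0 (2 * 4 ^ (p.unpair.1 + 1) - 1) :=
    primrec_codeMk
      (Primrec.succ.comp (Primrec.nat_mul.comp (.const 8) (primrec_unpair_snd Primrec.id)))
      (.const 0)
      (Primrec.nat_sub.comp (Primrec.nat_mul.comp (.const 2)
        (primrec_four_pow (Primrec.succ.comp (primrec_unpair_fst Primrec.id)))) (.const 1))
  have hdigit := (setReducible_iff_recIn_chi.1 (SetReducible.refl C)).comp
    (RecIn.of_primrec hcode)
  -- The query returns a digit only when fed the true prefix value, which the induction for `hN`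
  -- supplies.
  have hval : ∀ n, chi C (codeMk (8 * prefixValue A n + 1) 0 (2 * 4 ^ (n + 1) - 1)) =
      chi A n := by
    intro n
    have h1 : (1 : ℕ) ≤ 2 * 4 ^ (n + 1) := Nat.mul_pos two_pos (by positivity)
    have hiff : codeMk (8 * prefixValue A n + 1) 0 (2 * 4 ^ (n + 1) - 1) ∈ C ↔ n ∈ A := by
      rw [mem_iff_lt_quaternary A n, hC, leftCut, Set.mem_ofPred_eq,
        ratOfCode_codeMk_cast, Nat.cast_sub h1]
      push_cast
      rw [sub_zero, sub_add_cancel]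
    by_cases hn : n ∈ A
    · rw [chi_eq_one.2 hn, chi_eq_one.2 (hiff.2 hn)]
    · rw [chi_eq_zero.2 hn, chi_eq_zero.2 (mt hiff.1 hn)]
  have hstep : RecIn C fun p => 4 * p.unpair.2 +
      chi C (codeMk (8 * p.unpair.2 + 1) 0 (2 * 4 ^ (p.unpair.1 + 1) - 1)) :=
    .comp₂ Primrec.nat_add
      (.of_primrec (Primrec.nat_mul.comp (.const 4) (primrec_unpair_snd Primrec.id))) hdigit
  have hN : RecIn C (prefixValue A) := by
    have h := hstep.natRec 0
    refine h.of_eq fun n => congrArg Part.some ?_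
    simp only [Nat.unpair_pair]
    induction n with
    | zero => rfl
    | succ n ih =>
      simp only [ih]
      rw [hval, prefixValue_succ]
  rw [setReducible_iff_recIn_chi]
  refine (hdigit.comp ((RecIn.of_primrec Primrec.id).pair hN)).of_eq fun n =>
    congrArg Part.some ?_
  simp only [Nat.unpair_pair, id]
  exact hval n

theorem realDeg_quaternary (A : Set ℕ) : realDeg (quaternary A) = setDeg A :=
  le_antisymm (approximableIn_iff.1 (approximableIn_quaternary (.refl A)))
    (reducible_leftCut_quaternary A)

/-- Disjointness makes the digits add without carries. -/
theorem quaternary_union {A B : Set ℕ} (h : Disjoint A B) :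
    quaternary (A ∪ B) = quaternary A + quaternary B := by
  rw [quaternary, quaternary, quaternary,
    ← (summable_quaternary A).tsum_add (summable_quaternary B)]
  refine tsum_congr fun n => ?_
  rw [← add_mul]
  congr 1
  by_cases hA : n ∈ A
  · simp [chi, hA, Set.disjoint_left.1 h hA]
  · have hAB : n ∈ A ∪ B ↔ n ∈ B := ⟨fun hn => hn.resolve_left hA, Or.inr⟩
    rw [chi_eq_zero.2 hA, Nat.cast_zero, zero_add]
    by_cases hB : n ∈ B
    · rw [chi_eq_one.2 hB, chi_eq_one.2 (hAB.2 hB)]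
    · rw [chi_eq_zero.2 hB, chi_eq_zero.2 (mt hAB.1 hB)]

theorem quaternary_setJoin (A B : Set ℕ) :
    quaternary (setJoin A B) = quaternary (setJoin A ∅) + quaternary (setJoin ∅ B) := by
  rw [← quaternary_union]
  · congr 1
    simp [setJoin]
  · rw [Set.disjoint_left]
    rintro _ (⟨m, _, rfl⟩ | ⟨m, hm, rfl⟩) (⟨k, hk, h⟩ | ⟨k, _, h⟩)
    all_goals first | exact hm | exact hk | (simp only at h; omega)

theorem empty_reducible (C : Set ℕ) : SetReducible ∅ C :=
  setReducible_of_recIn (.of_primrec (.const 0)) (fun _ h => h.elim) fun _ _ => rfl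

theorem realDeg_quaternary_setJoin_empty (A : Set ℕ) :
    realDeg (quaternary (setJoin A ∅)) = setDeg A := by
  rw [realDeg_quaternary]
  exact le_antisymm (setJoin_le (.refl A) (empty_reducible A)) (left_le_setJoin A ∅)

theorem realDeg_quaternary_empty_setJoin (B : Set ℕ) :
    realDeg (quaternary (setJoin ∅ B)) = setDeg B := by
  rw [realDeg_quaternary]
  exact le_antisymm (setJoin_le (empty_reducible B) (.refl B)) (right_le_setJoin ∅ B)

/-! ### Subfields and ideals -/

theorem isTuringIdeal_of_subfield {S : Set Degree} (F : Subfield ℝ)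
    (hF : (F : Set ℝ) = realsOf S) : IsTuringIdeal S := by
  have mem : ∀ x, x ∈ F ↔ realDeg x ∈ S := fun x => by
    rw [← SetLike.mem_coe, hF]; rfl
  refine ⟨⟨_, (mem 0).1 F.zero_mem⟩, fun a b hba ha => ?_, fun a b ha hb => ?_⟩
  · induction a using Quotient.inductionOn with | _ A
    induction b using Quotient.inductionOn with | _ B
    change setDeg A ∈ S at ha
    change setDeg B ≤ setDeg A at hba
    change setDeg B ∈ S
    have hA : quaternary (setJoin A ∅) ∈ F := by
      rwa [mem, realDeg_quaternary_setJoin_empty]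
    -- As `B ≤ A`, the join has the degree of `A`.
    have hAB : quaternary (setJoin A B) ∈ F := by
      rwa [mem, realDeg_quaternary, ← setDeg_sup_setDeg, sup_eq_left.2 hba]
    have hB := F.sub_mem hAB hA
    rwa [quaternary_setJoin, add_sub_cancel_left, mem, realDeg_quaternary_empty_setJoin] at hB
  · induction a using Quotient.inductionOn with | _ A
    induction b using Quotient.inductionOn with | _ B
    change setDeg A ∈ S at ha
    change setDeg B ∈ S at hb
    change setDeg A ⊔ setDeg B ∈ S
    rw [setDeg_sup_setDeg, ← realDeg_quaternary, ← mem, quaternary_setJoin]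
    refine F.add_mem ?_ ?_
    · rwa [mem, realDeg_quaternary_setJoin_empty]
    · rwa [mem, realDeg_quaternary_empty_setJoin]

namespace IsTuringIdeal

variable {S : Set Degree} {x y z : ℝ}

theorem mem_realsOf (hS : IsTuringIdeal S) (hx : x ∈ realsOf S)
    (h : ∀ C, ApproximableIn C x → ApproximableIn C z) : z ∈ realsOf S :=
  hS.mem_of_le _ _ (approximableIn_iff.1 (h _ (approximableIn_iff.2 (.refl _)))) hx

/-- The join of the two cuts is an oracle that approximates both `x` and `y`, hence `z`; its degree
lies in the ideal. -/
theorem mem_realsOf₂ (hS : IsTuringIdeal S) (hx : x ∈ realsOf S) (hy : y ∈ realsOf S)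
    (h : ∀ C, ApproximableIn C x → ApproximableIn C y → ApproximableIn C z) :
    z ∈ realsOf S :=
  hS.mem_of_le _ _ (approximableIn_iff.1 (h (setJoin (leftCut x) (leftCut y))
    (approximableIn_iff.2 (left_le_setJoin _ _)) (approximableIn_iff.2 (right_le_setJoin _ _))))
    (hS.sup_mem _ _ hx hy)

theorem rat_mem_realsOf (hS : IsTuringIdeal S) (q : ℚ) : (q : ℝ) ∈ realsOf S := by
  obtain ⟨a, ha⟩ := hS.nonempty
  obtain ⟨c, rfl⟩ := ratOfCode_surjective q
  refine hS.mem_of_le a _ ?_ ha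
  induction a using Quotient.inductionOn with | _ A
  exact leftCut_reducible_of_rat c

/-- The field of the real numbers whose degrees belong to a Turing ideal. -/
def subfield (hS : IsTuringIdeal S) : Subfield ℝ where
  carrier := realsOf S
  zero_mem' := by simpa using hS.rat_mem_realsOf 0
  one_mem' := by simpa using hS.rat_mem_realsOf 1
  add_mem' hx hy := hS.mem_realsOf₂ hx hy fun _ => .add
  mul_mem' hx hy := hS.mem_realsOf₂ hx hy fun _ => .mul
  neg_mem' hx := hS.mem_realsOf hx fun _ => .neg
  inv_mem' _ hx := hS.mem_realsOf hx fun _ => .inv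

end IsTuringIdeal

end TuringReals

theorem mainTheorem6 (S : Set TuringReals.Degree) :
    (∃ F : Subfield ℝ, (F : Set ℝ) = TuringReals.realsOf S) ↔ TuringReals.IsTuringIdeal S :=
  ⟨fun ⟨F, hF⟩ => TuringReals.isTuringIdeal_of_subfield F hF, fun hS => ⟨hS.subfield, rfl⟩⟩
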